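/- Let $k\ge 1$, let $P$ be a finite set of primes, and let $\mathcal A_P$ be the class of finite abelian groups $G$ such that every prime dividing $|G|$ lies in $P$. Write $(a;q)_\infty=\prod_{i\ge 0}(1-aq^i)$ and $c_{P,k}=\prod_{p\in P}(p^{-1};p^{-1})_\infty^{\,k}$. A $k$-sequence is a diagram $G_k\xrightarrow{\phi_{k-1}}G_{k-1}\to\cdots\xrightarrow{\phi_1}G_1$ of groups in $\mathcal A_P$ and surjective homomorphisms. An isomorphism from $(G_i,\phi_i)$ to $(H_i,\psi_i)$ is a family of group isomorphisms $\varphi_i:G_i\to H_i$ $(1\le i\le k)$ with $\varphi_i\circ\phi_i=\psi_i\circ\varphi_{i+1}$ for $1\le i\le k-1$. Write $[G_k\twoheadrightarrow\cdots\twoheadrightarrow G_1]$ for the isomorphism class of a $k$-sequence and $\operatorname{Aut}(G_k\twoheadrightarrow\cdots\twoheadrightarrow G_1)$ for the group of its isomorphisms to itself. Then there is a well-defined probability measure $\widetilde{\mathbf P}_P^{(k)}$ on the (discrete) set of isomorphism classes of $k$-sequences such that, for every $k$-sequence, $$\widetilde{\mathbf P}_P^{(k)}\big([G_k\twoheadrightarrow\cdots\twoheadrightarrow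 G_1]\big)=\frac{c_{P,k}}{\#\operatorname{Aut}(G_k\twoheadrightarrow\cdots\twoheadrightarrow G_1)} .$$ Furthermore, under this measure the joint distribution of the isomorphism types of $G_1,\dots,G_k$ (forgetting the maps) is the law $\mathbf P_P^{(k)}$ with the following mass function: for all $B_1,\dots,B_k\in\mathcal A_P$, $$\widetilde{\mathbf P}_P^{(k)}\big(G_i\simeq B_i\text{ for all }1\le i\le k\big)=\mathbf P_P^{(k)}(B_1,\dots,B_k):=c_{P,k}\prod_{i=1}^k\frac{\#\operatorname{Sur}(B_i,B_{i-1})}{\#\operatorname{Aut}(B_i)},\qquad B_0:=0,$$ where $\operatorname{Sur}(G,H)$ is the set of surjective homomorphisms $G\to H$. -/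

import Mathlib

noncomputable section

/-- The infinite `q`-Pochhammer symbol `(a; q)_∞ = ∏_{i ≥ 0} (1 - a q ^ i)`. -/
def qPochhammerInf (a q : ℝ) : ℝ := ∏' i : ℕ, (1 - a * q ^ i)

/-- A finite abelian group (as an actual group, not an isomorphism class) such that every prime
dividing its order lies in `P`. Every finite group has a copy in `Type`. -/
structure FinAbGroup (P : Finset ℕ) where
  carrier : Type
  [addCommGroup : AddCommGroup carrier]
  [finite : Finite carrier]
  prime_mem : ∀ p : ℕ, p.Prime → p ∣ Nat.card carrier → p ∈ P

instance (P : Finset ℕ) : CoeSort (FinAbGroup P) Type := ⟨FinAbGroup.carrier⟩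

attribute [instance] FinAbGroup.addCommGroup FinAbGroup.finite

/-- Two groups are equivalent when they are isomorphic. -/
instance FinAbGroup.setoid (P : Finset ℕ) : Setoid (FinAbGroup P) where
  r G H := Nonempty (G ≃+ H)
  iseqv :=
    ⟨fun G => ⟨AddEquiv.refl G⟩, fun ⟨e⟩ => ⟨e.symm⟩, fun ⟨e⟩ ⟨f⟩ => ⟨e.trans f⟩⟩

/-- Isomorphism types of finite abelian groups whose order has all its prime factors in `P`. -/
def IsoType (P : Finset ℕ) : Type 1 := Quotient (FinAbGroup.setoid P)

/-- The set `Sur(G, H)` of surjective homomorphisms. -/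
def Sur (G H : Type) [AddCommGroup G] [AddCommGroup H] : Type :=
  {f : G →+ H // Function.Surjective f}

/-- A `k`-sequence `G_k ↠ ⋯ ↠ G_1` of finite abelian groups with prime factors of the orders
in `P` (as all maps are onto, this only restricts `|G_k|`). The group `G_{i+1}` of the usual
notation is `G i` for `i : Fin k`, and `φ i` is the surjection from `G (i + 1)` onto `G i`. -/
structure KSequence (P : Finset ℕ) (k : ℕ) where
  G : Fin k → FinAbGroup P
  φ : ∀ (i : ℕ) (h : i + 1 < k), G ⟨i + 1, h⟩ →+ G ⟨i, Nat.lt_of_succ_lt h⟩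
  surjective : ∀ (i : ℕ) (h : i + 1 < k), Function.Surjective (φ i h)

namespace KSequence

variable {P : Finset ℕ} {k : ℕ}

/-- An isomorphism of `k`-sequences: a family of group isomorphisms that commutes with the
surjections. -/
@[ext]
structure Iso (S T : KSequence P k) where
  equiv : ∀ i : Fin k, S.G i ≃+ T.G i
  comm : ∀ (i : ℕ) (h : i + 1 < k) (x : S.G ⟨i + 1, h⟩),
    equiv ⟨i, Nat.lt_of_succ_lt h⟩ (S.φ i h x) = T.φ i h (equiv ⟨i + 1, h⟩ x)

/-- The identity isomorphism. -/
def Iso.refl (S : KSequence P k) : Iso S S where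
  equiv i := AddEquiv.refl (S.G i)
  comm _ _ _ := rfl

/-- The inverse isomorphism. -/
def Iso.symm {S T : KSequence P k} (e : Iso S T) : Iso T S where
  equiv i := (e.equiv i).symm
  comm i h x := by
    rw [AddEquiv.symm_apply_eq, e.comm, AddEquiv.apply_symm_apply]

/-- Composition of isomorphisms. -/
def Iso.trans {S T U : KSequence P k} (e : Iso S T) (f : Iso T U) : Iso S U where
  equiv i := (e.equiv i).trans (f.equiv i)
  comm i h x := by
    simp only [AddEquiv.trans_apply, e.comm, f.comm]

/-- The automorphisms `Aut(G_k ↠ ⋯ ↠ G_1)` of a `k`-sequence. -/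
abbrev Aut (S : KSequence P k) : Type := Iso S S

/-- Two `k`-sequences are equivalent when they are isomorphic as `k`-sequences. -/
instance setoid (P : Finset ℕ) (k : ℕ) : Setoid (KSequence P k) where
  r S T := Nonempty (Iso S T)
  iseqv := ⟨fun S => ⟨Iso.refl S⟩, fun ⟨e⟩ => ⟨e.symm⟩, fun ⟨e⟩ ⟨f⟩ => ⟨e.trans f⟩⟩

end KSequence

/-- The set of equivalence classes `[G_k ↠ ⋯ ↠ G_1]` of `k`-sequences. -/
def KSequenceClass (P : Finset ℕ) (k : ℕ) : Type 1 := Quotient (KSequence.setoid P k)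

/-- The class of a `k`-sequence. -/
def KSequence.toClass {P : Finset ℕ} {k : ℕ} (S : KSequence P k) : KSequenceClass P k :=
  Quotient.mk _ S

/-- The isomorphism type of a group. -/
def FinAbGroup.isoType {P : Finset ℕ} (G : FinAbGroup P) : IsoType P := Quotient.mk _ G

/-- The isomorphism types of `G_1, …, G_k`, forgetting the maps between the groups. -/
def KSequenceClass.isoTypes {P : Finset ℕ} {k : ℕ} :
    KSequenceClass P k → (Fin k → IsoType P) :=
  Quotient.lift (fun (S : KSequence P k) (i : Fin k) => (S.G i).isoType)
    (fun _ _ ⟨e⟩ => funext fun i => Quotient.sound ⟨e.equiv i⟩)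

/-- The constant `∏_{p ∈ P} (p⁻¹; p⁻¹)_∞ ^ k`. -/
def normConst (P : Finset ℕ) (k : ℕ) : ℝ :=
  ∏ p ∈ P, qPochhammerInf (p : ℝ)⁻¹ (p : ℝ)⁻¹ ^ k

/-- The number `#Sur(B_i, B_{i-1})`, where `B_0 = 0`; the group `B_{i+1}` is `B i` for
`i : Fin k`. -/
def surCount {P : Finset ℕ} {k : ℕ} (B : Fin k → FinAbGroup P) : Fin k → ℕ
  | ⟨0, h⟩ => Nat.card (Sur (B ⟨0, h⟩) PUnit)
  | ⟨i + 1, h⟩ => Nat.card (Sur (B ⟨i + 1, h⟩) (B ⟨i, Nat.lt_of_succ_lt h⟩))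

/-- The joint law on isomorphism types `(B_1, …, B_k)`, given by its mass function
`∏_{p ∈ P} (p⁻¹; p⁻¹)_∞ ^ k * ∏_{i = 1}^k #Sur(B_i, B_{i-1}) / #Aut(B_i)`, with `B_0 = 0`. It is
the limiting joint law of the `P`-parts of `cok(M_1), cok(M_1 M_2), …, cok(M_1 ⋯ M_k)`. -/
def limitLaw (P : Finset ℕ) (k : ℕ) (B : Fin k → FinAbGroup P) : ℝ :=
  normConst P k * ∏ i : Fin k, (surCount B i : ℝ) / (Nat.card (B i ≃+ B i) : ℝ)

end

/-! Everything rests on one fact (`tsum_natCard_sur_div_natCard_aut`): the Cohen–Lenstra moment sum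
∑_B #Sur(B, H) / #Aut(B) over isomorphism types is c_{P,1}⁻¹, whatever H is.

Moments: #Sur(ℤⁿ, B) / #Aut(B) counts the subgroups of ℤⁿ with quotient B. Weight each by |B|⁻ⁿ and
count pairs L ≤ ker f with f : ℤⁿ ↠ H. Since ker f ≅ ℤⁿ, the moment sum, damped by the proportion of
homomorphisms ℤⁿ → B that are onto, equals that proportion for H times the P-part of the subgroup
zeta function of ℤⁿ at n (`tsum_moment_mul_surDensity`). Hermite normal form evaluates the zeta
value as a product (`subgroupZeta_int_pow`) that tends to c_{P,1}⁻¹, while the proportions tend to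
1.

Chains: as the moments do not depend on H, summing out B_k, …, B_1 in turn gives c_{P,1}⁻ᵏ. The
classes of k-sequences on fixed groups B_i are the orbits of ∏ Aut(B_i) on families of surjections,
with stabilizers the automorphism groups of the sequences. Hence their masses 1/#Aut add up to ∏
#Sur / #Aut (`tsum_isoTypes_eq`). This is the joint law, and summed over all B it gives the total
mass. -/

noncomputable section

open scoped ENNReal Topology
open Filter

/-! ### Multiplicative weights and the subgroup zeta function -/

/-- The weight `m ^ (-n)` of a positive integer all of whose prime factors lie in `P`; every other
number has weight `0`. -/
def factoredWeight (P : Finset ℕ) (n m : ℕ) : ℝ≥0∞ :=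
  open Classical in if m ∈ Nat.factoredNumbers P then ((m : ℝ≥0∞) ^ n)⁻¹ else 0

lemma mul_mem_factoredNumbers_iff {P : Finset ℕ} {a b : ℕ} :
    a * b ∈ Nat.factoredNumbers P ↔ a ∈ Nat.factoredNumbers P ∧ b ∈ Nat.factoredNumbers P := by
  refine ⟨fun h => ?_, fun h => Nat.mul_mem_factoredNumbers h.1 h.2⟩
  exact ⟨Nat.mem_factoredNumbers_of_dvd h (dvd_mul_right a b),
    Nat.mem_factoredNumbers_of_dvd h (dvd_mul_left b a)⟩

lemma factoredWeight_of_mem {P : Finset ℕ} {n m : ℕ} (h : m ∈ Nat.factoredNumbers P) :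
    factoredWeight P n m = ((m : ℝ≥0∞) ^ n)⁻¹ := by
  simp [factoredWeight, h]

lemma factoredWeight_of_notMem {P : Finset ℕ} {n m : ℕ} (h : m ∉ Nat.factoredNumbers P) :
    factoredWeight P n m = 0 := by
  simp [factoredWeight, h]

lemma zero_notMem_factoredNumbers (P : Finset ℕ) : 0 ∉ Nat.factoredNumbers P :=
  fun h => Nat.ne_zero_of_mem_factoredNumbers h rfl

lemma one_mem_factoredNumbers (P : Finset ℕ) : 1 ∈ Nat.factoredNumbers P := by
  simp [Nat.mem_factoredNumbers]

@[simp] lemma factoredWeight_zero (P : Finset ℕ) (n : ℕ) : factoredWeight P n 0 = 0 :=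
  factoredWeight_of_notMem (zero_notMem_factoredNumbers P)

lemma factoredWeight_one (P : Finset ℕ) (n : ℕ) : factoredWeight P n 1 = 1 := by
  simp [factoredWeight_of_mem (one_mem_factoredNumbers P)]

lemma factoredWeight_mul (P : Finset ℕ) (n a b : ℕ) :
    factoredWeight P n (a * b) = factoredWeight P n a * factoredWeight P n b := by
  by_cases h : a * b ∈ Nat.factoredNumbers P
  · obtain ⟨ha, hb⟩ := mul_mem_factoredNumbers_iff.1 h
    rw [factoredWeight_of_mem h, factoredWeight_of_mem ha, factoredWeight_of_mem hb,
      Nat.cast_mul, mul_pow, ENNReal.mul_inv]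
    · exact Or.inl (pow_ne_zero _ (by exact_mod_cast Nat.ne_zero_of_mem_factoredNumbers ha))
    · exact Or.inl (by finiteness)
  · rw [factoredWeight_of_notMem h]
    rw [mul_mem_factoredNumbers_iff, not_and_or] at h
    rcases h with h | h <;> simp [factoredWeight_of_notMem h]

lemma natCast_mul_factoredWeight_succ (P : Finset ℕ) (n m : ℕ) :
    (m : ℝ≥0∞) * factoredWeight P (n + 1) m = factoredWeight P n m := by
  by_cases h : m ∈ Nat.factoredNumbers P
  · have h0 : (m : ℝ≥0∞) ≠ 0 := by exact_mod_cast Nat.ne_zero_of_mem_factoredNumbers h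
    rw [factoredWeight_of_mem h, factoredWeight_of_mem h, pow_succ,
      ENNReal.mul_inv (Or.inl (pow_ne_zero _ h0)) (Or.inl (by finiteness)), mul_left_comm,
      ENNReal.mul_inv_cancel h0 (by finiteness), mul_one]
  · simp [factoredWeight_of_notMem h]

/-- The `P`-part of the subgroup zeta function of `M`, at `n`. -/
def subgroupZeta (P : Finset ℕ) (M : Type) [AddCommGroup M] (n : ℕ) : ℝ≥0∞ :=
  ∑' L : AddSubgroup M, factoredWeight P n L.index

lemma subgroupZeta_congr (P : Finset ℕ) {M N : Type} [AddCommGroup M] [AddCommGroup N]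
    (e : M ≃+ N) (n : ℕ) : subgroupZeta P M n = subgroupZeta P N n := by
  rw [subgroupZeta, subgroupZeta, ← e.mapAddSubgroup.toEquiv.tsum_eq]
  exact tsum_congr fun L => congrArg _ (L.index_map_equiv e).symm

/-! ### Hermite normal form for subgroups of M × ℤ -/

section Hermite

variable {M : Type} [AddCommGroup M]

/-- The subgroup of `M × ℤ` that meets `M` in `L`, has image `dℤ` in `ℤ`, and contains the
elements `(m, d)` with `m` in the class `x`. -/
def AddSubgroup.hermite (L : AddSubgroup M) (d : ℕ) (x : M ⧸ L) : AddSubgroup (M × ℤ) where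
  carrier := {z | ∃ s : ℤ, z.2 = d * s ∧ (z.1 : M ⧸ L) = s • x}
  zero_mem' := ⟨0, by simp, by simp⟩
  add_mem' := by
    rintro ⟨a, b⟩ ⟨a', b'⟩ ⟨s, hs, hs'⟩ ⟨t, ht, ht'⟩
    exact ⟨s + t, by simp_all [mul_add], by simp_all [add_smul]⟩
  neg_mem' := by
    rintro ⟨a, b⟩ ⟨s, hs, hs'⟩
    exact ⟨-s, by simp_all, by simp_all⟩

lemma AddSubgroup.mem_hermite {L : AddSubgroup M} {d : ℕ} {x : M ⧸ L} {z : M × ℤ} :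
    z ∈ L.hermite d x ↔ ∃ s : ℤ, z.2 = d * s ∧ (z.1 : M ⧸ L) = s • x := Iff.rfl

lemma AddSubgroup.comap_inl_hermite (L : AddSubgroup M) {d : ℕ} (hd : d ≠ 0) (x : M ⧸ L) :
    (L.hermite d x).comap (AddMonoidHom.inl M ℤ) = L := by
  ext m
  simp only [AddSubgroup.mem_comap, AddMonoidHom.inl_apply, AddSubgroup.mem_hermite]
  constructor
  · rintro ⟨s, hs, hs'⟩
    have : s = 0 := by simpa [hd] using hs.symm
    simpa [this] using hs'
  · intro h
    exact ⟨0, by simp, by simpa using h⟩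

lemma AddSubgroup.map_snd_hermite (L : AddSubgroup M) (d : ℕ) (x : M ⧸ L) :
    (L.hermite d x).map (AddMonoidHom.snd M ℤ) = AddSubgroup.zmultiples (d : ℤ) := by
  ext t
  simp only [AddSubgroup.mem_map, AddSubgroup.mem_hermite, Int.mem_zmultiples_iff]
  constructor
  · rintro ⟨z, ⟨s, hs, -⟩, rfl⟩
    exact ⟨s, hs⟩
  · rintro ⟨s, rfl⟩
    obtain ⟨m, hm⟩ := QuotientAddGroup.mk_surjective (s • x)
    exact ⟨(m, d * s), ⟨s, rfl, hm⟩, rfl⟩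

/-- The tower L ≤ L + M ≤ M × ℤ, whose lower step has index [M : L ∩ M]. With 0 as the value of an
infinite index, no finiteness is needed. -/
lemma AddSubgroup.index_eq_comap_inl_mul_map_snd (L : AddSubgroup (M × ℤ)) :
    L.index = (L.comap (AddMonoidHom.inl M ℤ)).index *
      (L.map (AddMonoidHom.snd M ℤ)).index := by
  have h : (AddMonoidHom.inl M ℤ).range = (AddMonoidHom.snd M ℤ).ker := by
    ext ⟨m, t⟩
    simp only [AddMonoidHom.mem_range, AddMonoidHom.mem_ker, AddMonoidHom.inl_apply, Prod.ext_iff,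
      AddMonoidHom.coe_snd]
    exact ⟨fun ⟨_, _, h⟩ => h.symm, fun h => ⟨m, rfl, h.symm⟩⟩
  rw [AddSubgroup.index_map, AddSubgroup.index_comap, h,
    AddMonoidHom.range_eq_top.2 Prod.snd_surjective, AddSubgroup.index_top, mul_one,
    ← AddSubgroup.relIndex_mul_index (le_sup_left : L ≤ L ⊔ (AddMonoidHom.snd M ℤ).ker), sup_comm,
    AddSubgroup.relIndex_sup_right]

lemma AddSubgroup.index_hermite (L : AddSubgroup M) {d : ℕ} (hd : d ≠ 0) (x : M ⧸ L) :
    (L.hermite d x).index = L.index * d := by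
  rw [AddSubgroup.index_eq_comap_inl_mul_map_snd, L.comap_inl_hermite hd, L.map_snd_hermite,
    Int.index_zmultiples, Int.natAbs_natCast]

/-- All subgroups `AddSubgroup.hermite L d x` with `d > 0`. -/
def AddSubgroup.hermiteSigma (z : Σ p : AddSubgroup M × ℕ+, M ⧸ p.1) : AddSubgroup (M × ℤ) :=
  z.1.1.hermite z.1.2 z.2

/-- L is the intersection with M, d the index of the image in ℤ, and x the class of any m with (m,
d) in the subgroup. -/
lemma AddSubgroup.hermiteSigma_injective :
    Function.Injective (AddSubgroup.hermiteSigma (M := M)) := by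
  rintro ⟨⟨L, d⟩, x⟩ ⟨⟨L', d'⟩, x'⟩ h
  simp only [AddSubgroup.hermiteSigma] at h
  obtain rfl : L = L' := by
    rw [← L.comap_inl_hermite d.ne_zero x, h, L'.comap_inl_hermite d'.ne_zero]
  obtain rfl : d = d' := by
    have := congrArg AddSubgroup.index ((L.map_snd_hermite d x).symm.trans
      ((congrArg _ h).trans (L.map_snd_hermite d' x')))
    simpa [Int.index_zmultiples] using this
  obtain ⟨m, rfl⟩ := QuotientAddGroup.mk_surjective x
  have hm : (m, (d : ℤ)) ∈ L.hermite d (m : M ⧸ L) := ⟨1, by simp, by simp⟩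
  rw [h] at hm
  obtain ⟨s, hs, hs'⟩ := hm
  have : s = 1 := by
    have h0 : ((d : ℕ) : ℤ) ≠ 0 := by exact_mod_cast d.ne_zero
    exact (mul_left_cancel₀ h0 (by simpa using hs)).symm
  subst this
  rw [one_smul] at hs'
  rw [← hs']

lemma AddSubgroup.mem_range_hermiteSigma {L : AddSubgroup (M × ℤ)} (hL : L.index ≠ 0) :
    L ∈ Set.range (AddSubgroup.hermiteSigma (M := M)) := by
  obtain ⟨a, ha⟩ := Int.subgroup_cyclic (L.map (AddMonoidHom.snd M ℤ))
  have ha' : L.map (AddMonoidHom.snd M ℤ) = AddSubgroup.zmultiples a := by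
    rw [ha, AddSubgroup.zmultiples_eq_closure]
  have ha0 : a.natAbs ≠ 0 := by
    intro h
    rw [AddSubgroup.index_eq_comap_inl_mul_map_snd, ha', Int.index_zmultiples, h] at hL
    simp at hL
  have hmap : L.map (AddMonoidHom.snd M ℤ) = AddSubgroup.zmultiples (a.natAbs : ℤ) := by
    rw [ha', Int.zmultiples_natAbs]
  obtain ⟨⟨m, t⟩, hm, ht⟩ : (a.natAbs : ℤ) ∈ L.map (AddMonoidHom.snd M ℤ) := by
    rw [hmap]; exact AddSubgroup.mem_zmultiples _
  simp only [AddMonoidHom.coe_snd] at ht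
  subst ht
  refine ⟨⟨⟨L.comap (AddMonoidHom.inl M ℤ), ⟨a.natAbs, Nat.pos_of_ne_zero ha0⟩⟩, m⟩, ?_⟩
  -- Subtracting s • (m, d) from (m', ds) lands in M, so membership is decided by L ∩ M.
  have key : ∀ (m' : M) (s : ℤ), (m', (a.natAbs : ℤ) * s) ∈ L ↔
      (m' : M ⧸ L.comap (AddMonoidHom.inl M ℤ)) = s • (m : M ⧸ L.comap (AddMonoidHom.inl M ℤ)) := by
    intro m' s
    rw [← QuotientAddGroup.mk_zsmul, eq_comm, QuotientAddGroup.eq, AddSubgroup.mem_comap]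
    have : (m', (a.natAbs : ℤ) * s) =
        s • (m, (a.natAbs : ℤ)) + AddMonoidHom.inl M ℤ (-(s • m) + m') := by
      ext <;> simp [mul_comm]
    rw [this, AddSubgroup.add_mem_cancel_left _ (L.zsmul_mem hm s)]
  ext ⟨m', t⟩
  simp only [AddSubgroup.hermiteSigma, AddSubgroup.mem_hermite, PNat.mk_coe]
  constructor
  · rintro ⟨s, rfl, hs⟩
    exact (key m' s).2 hs
  · intro h
    have : t ∈ L.map (AddMonoidHom.snd M ℤ) := ⟨_, h, rfl⟩
    rw [hmap, Int.mem_zmultiples_iff] at this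
    obtain ⟨s, rfl⟩ := this
    exact ⟨s, rfl, (key m' s).1 h⟩

end Hermite

/-! ### Euler products and the zeta function of ℤⁿ -/

/-- Each pair (L, d) has [M : L] choices of x, all giving index [M : L] · d. The factor [M : L]
lowers the exponent on L from n + 1 to n. -/
lemma subgroupZeta_prod_int (P : Finset ℕ) (M : Type) [AddCommGroup M] (n : ℕ) :
    subgroupZeta P (M × ℤ) (n + 1) =
      subgroupZeta P M n * ∑' d : ℕ, factoredWeight P (n + 1) d := by
  have hsupp : Function.support
      (fun L : AddSubgroup (M × ℤ) => factoredWeight P (n + 1) L.index) ⊆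
      Set.range (AddSubgroup.hermiteSigma (M := M)) := by
    intro L hL
    refine AddSubgroup.mem_range_hermiteSigma fun h => hL ?_
    simp [h]
  have hd : ∑' d : ℕ, factoredWeight P (n + 1) d = ∑' d : ℕ+, factoredWeight P (n + 1) d := by
    refine (PNat.coe_injective.tsum_eq ?_).symm
    intro d hd
    refine ⟨⟨d, Nat.pos_of_ne_zero fun h => hd ?_⟩, rfl⟩
    simp [h]
  rw [subgroupZeta, ← AddSubgroup.hermiteSigma_injective.tsum_eq hsupp, ENNReal.tsum_sigma',
    ENNReal.tsum_prod', hd, subgroupZeta, ← ENNReal.tsum_mul_right]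
  refine tsum_congr fun L => ?_
  rw [← ENNReal.tsum_mul_left]
  refine tsum_congr fun d => ?_
  simp only [AddSubgroup.hermiteSigma, AddSubgroup.index_hermite _ d.ne_zero, ENNReal.tsum_const,
    factoredWeight_mul]
  rw [← natCast_mul_factoredWeight_succ P n, ← mul_assoc]
  -- For infinite index there are infinitely many x, but the weight is 0.
  by_cases h : L.index = 0
  · simp [h]
  · congr 2
    have : L.FiniteIndex := ⟨h⟩
    have : Finite (M ⧸ L) := inferInstance
    rw [ENat.card_eq_coe_natCard]
    rfl

lemma tsum_factoredWeight {P : Finset ℕ} (hP : ∀ p ∈ P, p.Prime) (n : ℕ) :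
    ∑' d : ℕ, factoredWeight P (n + 1) d =
      ENNReal.ofReal (∏ p ∈ P, (1 - ((p : ℝ)⁻¹) ^ (n + 1)))⁻¹ := by
  let f : ℕ →* ℝ :=
    { toFun := fun m => ((m : ℝ)⁻¹) ^ (n + 1)
      map_one' := by simp
      map_mul' := fun a b => by simp [mul_pow, mul_comm] }
  have hf : ∀ {p : ℕ}, p.Prime → ‖f p‖ < 1 := by
    intro p hp
    have h1 : (1 : ℝ) < p := by exact_mod_cast hp.one_lt
    have : ((p : ℝ)⁻¹) ^ (n + 1) < 1 :=
      pow_lt_one₀ (by positivity) (inv_lt_one_of_one_lt₀ h1) n.succ_ne_zero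
    simpa [f, abs_of_nonneg] using this
  obtain ⟨hs, hsum⟩ :=
    EulerProduct.summable_and_hasSum_factoredNumbers_prod_filter_prime_geometric hf P
  have h1 : ∑' d : ℕ, factoredWeight P (n + 1) d =
      ∑' d : Nat.factoredNumbers P, ENNReal.ofReal (f d) := by
    have hsupp : Function.support (factoredWeight P (n + 1)) ⊆
        Set.range ((↑) : Nat.factoredNumbers P → ℕ) := by
      intro d hd
      rw [Subtype.range_coe]
      by_contra h
      exact hd (factoredWeight_of_notMem h)
    rw [← Subtype.val_injective.tsum_eq hsupp]
    refine tsum_congr fun d => ?_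
    have hd : (0 : ℝ) < d := by
      exact_mod_cast Nat.pos_of_ne_zero (Nat.ne_zero_of_mem_factoredNumbers d.2)
    rw [factoredWeight_of_mem d.2]
    simp only [f, MonoidHom.coe_mk, OneHom.coe_mk]
    rw [inv_pow, ENNReal.ofReal_inv_of_pos (by positivity), ENNReal.ofReal_pow hd.le,
      ENNReal.ofReal_natCast]
  rw [h1, ← ENNReal.ofReal_tsum_of_nonneg (fun d => by
      simp only [f, MonoidHom.coe_mk, OneHom.coe_mk]
      positivity) hsum.summable, hsum.tsum_eq, Finset.filter_true_of_mem hP, Finset.prod_inv_distrib]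
  rfl

/-- The partial products of `∏ p ∈ P, (p⁻¹; p⁻¹)_∞`. -/
def pochhammerPartial (P : Finset ℕ) (n : ℕ) : ℝ :=
  ∏ i ∈ Finset.range n, ∏ p ∈ P, (1 - ((p : ℝ)⁻¹) ^ (i + 1))

lemma one_sub_inv_pow_pos {p : ℕ} (hp : p.Prime) (i : ℕ) : 0 < 1 - ((p : ℝ)⁻¹) ^ (i + 1) := by
  have h1 : (1 : ℝ) < p := by exact_mod_cast hp.one_lt
  exact sub_pos.2 (pow_lt_one₀ (by positivity) (inv_lt_one_of_one_lt₀ h1) i.succ_ne_zero)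

lemma pochhammerPartial_pos {P : Finset ℕ} (hP : ∀ p ∈ P, p.Prime) (n : ℕ) :
    0 < pochhammerPartial P n :=
  Finset.prod_pos fun i _ => Finset.prod_pos fun p hp => one_sub_inv_pow_pos (hP p hp) i

lemma subgroupZeta_int_pow {P : Finset ℕ} (hP : ∀ p ∈ P, p.Prime) (n : ℕ) :
    subgroupZeta P (Fin n → ℤ) n = ENNReal.ofReal (pochhammerPartial P n)⁻¹ := by
  induction n with
  | zero =>
    have : Subsingleton (AddSubgroup (Fin 0 → ℤ)) := inferInstance
    rw [subgroupZeta, tsum_eq_single ⊤ (fun L hL => absurd (Subsingleton.elim _ _) hL)]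
    simp [factoredWeight_one, pochhammerPartial]
  | succ n ih =>
    have e : (Fin (n + 1) → ℤ) ≃+ (Fin n → ℤ) × ℤ :=
      { (Fin.consEquiv (fun _ => ℤ)).symm.trans (Equiv.prodComm _ _) with
        map_add' := fun _ _ => rfl }
    rw [subgroupZeta_congr P e, subgroupZeta_prod_int, ih, tsum_factoredWeight hP,
      ← ENNReal.ofReal_mul (inv_nonneg.2 (pochhammerPartial_pos hP n).le), ← mul_inv,
      pochhammerPartial, pochhammerPartial, Finset.prod_range_succ]

lemma summable_inv_mul_inv_pow {p : ℕ} (hp : p.Prime) :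
    Summable fun i : ℕ => ‖-((p : ℝ)⁻¹ * (p : ℝ)⁻¹ ^ i)‖ := by
  have h1 : (1 : ℝ) < p := by exact_mod_cast hp.one_lt
  simp only [norm_neg]
  exact ((summable_geometric_of_lt_one (by positivity)
    (inv_lt_one_of_one_lt₀ h1)).mul_left (p : ℝ)⁻¹).norm

lemma tendsto_qPochhammerInf {p : ℕ} (hp : p.Prime) :
    Tendsto (fun n => ∏ i ∈ Finset.range n, (1 - ((p : ℝ)⁻¹) ^ (i + 1))) atTop
      (𝓝 (qPochhammerInf (p : ℝ)⁻¹ (p : ℝ)⁻¹)) := by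
  have := (multipliable_one_add_of_summable
    (summable_inv_mul_inv_pow hp)).tendsto_prod_tprod_nat
  simpa only [qPochhammerInf, ← sub_eq_add_neg, ← pow_succ'] using this

/-- Positive partial products only give a nonnegative limit; it is nonzero because the factors are
nonzero and the deviations from 1 are summable. -/
lemma qPochhammerInf_pos {p : ℕ} (hp : p.Prime) :
    0 < qPochhammerInf (p : ℝ)⁻¹ (p : ℝ)⁻¹ := by
  refine lt_of_le_of_ne' (ge_of_tendsto' (tendsto_qPochhammerInf hp) fun n =>
    Finset.prod_nonneg fun i _ => (one_sub_inv_pow_pos hp i).le) ?_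
  have := tprod_one_add_ne_zero_of_summable (f := fun i : ℕ => -((p : ℝ)⁻¹ * (p : ℝ)⁻¹ ^ i))
    (fun i => ?_) (summable_inv_mul_inv_pow hp)
  · simpa only [qPochhammerInf, ← sub_eq_add_neg] using this
  · rw [← sub_eq_add_neg, ← pow_succ']
    exact (one_sub_inv_pow_pos hp i).ne'

lemma normConst_eq_pow (P : Finset ℕ) (k : ℕ) : normConst P k = normConst P 1 ^ k := by
  simp [normConst, Finset.prod_pow]

lemma normConst_pos {P : Finset ℕ} (hP : ∀ p ∈ P, p.Prime) (k : ℕ) : 0 < normConst P k :=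
  Finset.prod_pos fun p hp => pow_pos (qPochhammerInf_pos (hP p hp)) k

lemma tendsto_subgroupZeta_int_pow {P : Finset ℕ} (hP : ∀ p ∈ P, p.Prime) :
    Tendsto (fun n => subgroupZeta P (Fin n → ℤ) n) atTop
      (𝓝 (ENNReal.ofReal (normConst P 1)⁻¹)) := by
  simp only [subgroupZeta_int_pow hP]
  refine ENNReal.tendsto_ofReal (Tendsto.inv₀ ?_ (normConst_pos hP 1).ne')
  have h : pochhammerPartial P =
      fun n => ∏ p ∈ P, ∏ i ∈ Finset.range n, (1 - ((p : ℝ)⁻¹) ^ (i + 1)) :=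
    funext fun n => Finset.prod_comm
  simp only [h, normConst, pow_one]
  exact tendsto_finsetProd _ fun p hp => tendsto_qPochhammerInf (hP p hp)

/-! ### Finite-index subgroups of ℤⁿ -/

/-- A subgroup of finite index of `ℤⁿ` is isomorphic to `ℤⁿ`. -/
lemma nonempty_addEquiv_int_pow {n : ℕ} (K : AddSubgroup (Fin n → ℤ)) (hK : K.index ≠ 0) :
    Nonempty (K ≃+ (Fin n → ℤ)) := by
  let K' : Submodule ℤ (Fin n → ℤ) := AddSubgroup.toIntSubmodule K
  have hfin : Finite ((Fin n → ℤ) ⧸ K') :=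
    have : K.FiniteIndex := ⟨hK⟩
    inferInstanceAs (Finite ((Fin n → ℤ) ⧸ K))
  -- The order of the finite quotient kills it, so it is torsion of rank 0 and K has full rank n.
  have h0 : Module.finrank ℤ ((Fin n → ℤ) ⧸ K') = 0 := by
    rw [Module.finrank_eq_zero_iff_isTorsion]
    intro x
    refine ⟨⟨(Nat.card ((Fin n → ℤ) ⧸ K') : ℤ), ?_⟩, ?_⟩
    · exact mem_nonZeroDivisors_of_ne_zero (by exact_mod_cast Nat.card_pos.ne')
    · change ((Nat.card ((Fin n → ℤ) ⧸ K') : ℕ) : ℤ) • x = 0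
      rw [natCast_zsmul]
      exact card_nsmul_eq_zero'
  have h1 := Submodule.finrank_quotient_add_finrank K'
  rw [h0, zero_add] at h1
  exact ⟨(LinearEquiv.ofFinrankEq K' (Fin n → ℤ) h1).toAddEquiv⟩

lemma subgroupZeta_of_index_ne_zero (P : Finset ℕ) {n : ℕ} (K : AddSubgroup (Fin n → ℤ))
    (hK : K.index ≠ 0) (m : ℕ) : subgroupZeta P K m = subgroupZeta P (Fin n → ℤ) m := by
  obtain ⟨e⟩ := nonempty_addEquiv_int_pow K hK
  exact subgroupZeta_congr P e m

/-- The sum over the subgroups contained in a given subgroup `K`. -/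
lemma tsum_le_factoredWeight (P : Finset ℕ) {M : Type} [AddCommGroup M] (K : AddSubgroup M)
    (n : ℕ) :
    ∑' L : {L : AddSubgroup M // L ≤ K}, factoredWeight P n L.1.index =
      factoredWeight P n K.index * subgroupZeta P K n := by
  rw [subgroupZeta, ← ENNReal.tsum_mul_left,
    ← (AddSubgroup.MapSubtype.orderIso K).toEquiv.tsum_eq]
  refine tsum_congr fun L => ?_
  rw [← factoredWeight_mul, mul_comm, ← AddSubgroup.index_map_subtype]
  rfl

/-! ### Surjections, kernels and quotients -/

section Surjections

variable {M G H : Type} [AddCommGroup M] [AddCommGroup G] [AddCommGroup H]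

instance AddMonoidHom.finite_of_fg [AddGroup.FG M] [Finite G] : Finite (M →+ G) := by
  obtain ⟨S, hS⟩ := AddGroup.FG.out (H := M)
  refine Finite.of_injective (fun (f : M →+ G) (x : S) => f x) fun f g h => ?_
  exact AddMonoidHom.eq_of_eqOn_dense hS fun x hx => congrFun h ⟨x, hx⟩

instance finite_sur [Finite (M →+ G)] : Finite (Sur M G) :=
  inferInstanceAs (Finite {f : M →+ G // Function.Surjective f})

lemma tsum_one_eq_natCard (α : Type*) [Finite α] : ∑' _ : α, (1 : ℝ≥0∞) = Nat.card α := by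
  rw [ENNReal.tsum_const, mul_one, ENat.card_eq_coe_natCard, ENat.toENNReal_coe]

/-- A surjection from `M` onto `G` is a subgroup of `M` with an identification of the quotient
with `G`. -/
def sigmaQuotientEquivSur (M G : Type) [AddCommGroup M] [AddCommGroup G] :
    (Σ L : AddSubgroup M, (M ⧸ L ≃+ G)) ≃ Sur M G :=
  Equiv.ofBijective
    (fun z => ⟨z.2.toAddMonoidHom.comp (QuotientAddGroup.mk' z.1),
      z.2.surjective.comp (QuotientAddGroup.mk'_surjective z.1)⟩) <| by
    constructor
    · rintro ⟨L, e⟩ ⟨L', e'⟩ h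
      have h' : ∀ m : M, e m = e' m := fun m => DFunLike.congr_fun (congrArg Subtype.val h) m
      obtain rfl : L = L' := by
        ext m
        rw [← QuotientAddGroup.eq_zero_iff, ← QuotientAddGroup.eq_zero_iff,
          ← e.map_eq_zero_iff, ← e'.map_eq_zero_iff, h']
      congr 1
      ext x
      obtain ⟨m, rfl⟩ := QuotientAddGroup.mk_surjective x
      exact h' m
    · rintro ⟨f, hf⟩
      exact ⟨⟨f.ker, QuotientAddGroup.quotientKerEquivOfSurjective f hf⟩, rfl⟩

open Classical in
-- Group surjections by kernel: the identifications of M ⧸ L with G, if any, form a torsor under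
-- Aut(G).
lemma natCard_sur_eq_tsum [Finite G] [Finite (Sur M G)] :
    (Nat.card (Sur M G) : ℝ≥0∞) =
      ∑' L : AddSubgroup M, if Nonempty (M ⧸ L ≃+ G) then (Nat.card (G ≃+ G) : ℝ≥0∞) else 0 := by
  rw [← tsum_one_eq_natCard, ← (sigmaQuotientEquivSur M G).tsum_eq, ENNReal.tsum_sigma']
  refine tsum_congr fun L => ?_
  split_ifs with h
  · obtain ⟨e⟩ := h
    rw [← tsum_one_eq_natCard]
    let E : (M ⧸ L ≃+ G) ≃ (G ≃+ G) :=
      { toFun := fun f => e.symm.trans f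
        invFun := fun f => e.trans f
        left_inv := fun f => by ext; simp
        right_inv := fun f => by ext; simp }
    exact E.tsum_eq (fun _ => (1 : ℝ≥0∞))
  · have := not_nonempty_iff.1 h
    exact tsum_empty

/-- Surjections from a quotient. -/
def surQuotientEquiv (L : AddSubgroup M) (H : Type) [AddCommGroup H] :
    Sur (M ⧸ L) H ≃ {f : Sur M H // L ≤ f.1.ker} where
  toFun f := ⟨⟨f.1.comp (QuotientAddGroup.mk' L), f.2.comp (QuotientAddGroup.mk'_surjective L)⟩,
    fun m hm => by
      have : (m : M ⧸ L) = 0 := (QuotientAddGroup.eq_zero_iff m).2 hm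
      simp [AddMonoidHom.mem_ker, this]⟩
  invFun f := ⟨QuotientAddGroup.lift L f.1.1 f.2,
    QuotientAddGroup.lift_surjective_of_surjective L f.1.1 f.1.2 f.2⟩
  left_inv f := Subtype.ext (by ext; rfl)
  right_inv f := Subtype.ext (Subtype.ext (by ext; rfl))

/-- Precomposition with an isomorphism. -/
def surCongrLeft (e : M ≃+ G) (H : Type) [AddCommGroup H] : Sur M H ≃ Sur G H where
  toFun f := ⟨f.1.comp e.symm.toAddMonoidHom, f.2.comp e.symm.surjective⟩
  invFun f := ⟨f.1.comp e.toAddMonoidHom, f.2.comp e.surjective⟩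
  left_inv f := Subtype.ext (by ext; simp)
  right_inv f := Subtype.ext (by ext; simp)

open Classical in
-- Double count of pairs L ≤ ker f, using multiplicativity of the index in L ≤ ker f ≤ M.
lemma tsum_natCard_sur_quotient (P : Finset ℕ) [Finite H] (n : ℕ) [Finite (Sur M H)] :
    ∑' L : AddSubgroup M, (Nat.card (Sur (M ⧸ L) H) : ℝ≥0∞) * factoredWeight P n L.index =
      ∑' f : Sur M H, factoredWeight P n f.1.ker.index * subgroupZeta P f.1.ker n := by
  have h1 : ∀ L : AddSubgroup M,
      (Nat.card (Sur (M ⧸ L) H) : ℝ≥0∞) * factoredWeight P n L.index =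
        ∑' f : Sur M H, if L ≤ f.1.ker then factoredWeight P n L.index else 0 := by
    intro L
    rw [Nat.card_congr (surQuotientEquiv L H), ← tsum_one_eq_natCard, ← ENNReal.tsum_mul_right]
    simp only [one_mul]
    exact tsum_subtype {f : Sur M H | L ≤ f.1.ker} (fun _ => factoredWeight P n L.index)
  simp only [h1]
  rw [ENNReal.tsum_comm]
  refine tsum_congr fun f => ?_
  rw [← tsum_le_factoredWeight]
  exact (tsum_subtype {L : AddSubgroup M | L ≤ f.1.ker} (fun L => factoredWeight P n L.index)).symm

end Surjections

/-! ### Sums over isomorphism types -/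

namespace FinAbGroup

variable {P : Finset ℕ}

lemma natCard_mem_factoredNumbers (G : FinAbGroup P) : Nat.card G ∈ Nat.factoredNumbers P :=
  Nat.mem_factoredNumbers'.2 G.prime_mem

end FinAbGroup

namespace IsoType

variable {P : Finset ℕ}

/-- A group of a given isomorphism type. -/
def out (b : IsoType P) : FinAbGroup P := Quotient.out b

@[simp] lemma isoType_out (b : IsoType P) : b.out.isoType = b := Quotient.out_eq b

end IsoType

lemma FinAbGroup.isoType_eq_iff {P : Finset ℕ} {G H : FinAbGroup P} :
    G.isoType = H.isoType ↔ Nonempty (G ≃+ H) := Quotient.eq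

open Classical in
-- At most one type matches M ⧸ L; none does when the index has a prime outside P or is infinite,
-- and then the weight vanishes too.
lemma tsum_isoType_quotient {P : Finset ℕ} {M : Type} [AddCommGroup M] (L : AddSubgroup M)
    (H : Type) [AddCommGroup H] (n : ℕ) :
    ∑' b : IsoType P, (if Nonempty (M ⧸ L ≃+ b.out) then
        (Nat.card (Sur b.out H) : ℝ≥0∞) * ((Nat.card b.out : ℝ≥0∞) ^ n)⁻¹ else 0) =
      (Nat.card (Sur (M ⧸ L) H) : ℝ≥0∞) * factoredWeight P n L.index := by
  by_cases h : L.index ∈ Nat.factoredNumbers P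
  · have : L.FiniteIndex := ⟨Nat.ne_zero_of_mem_factoredNumbers h⟩
    let Q : FinAbGroup P :=
      { carrier := M ⧸ L
        prime_mem := Nat.mem_factoredNumbers'.1 h }
    have hQ : ∀ b : IsoType P, Nonempty (M ⧸ L ≃+ b.out) ↔ b = Q.isoType := fun b => by
      rw [← FinAbGroup.isoType_eq_iff (G := Q), IsoType.isoType_out, eq_comm]
    rw [tsum_eq_single Q.isoType fun b hb => if_neg fun h => hb ((hQ b).1 h),
      if_pos ((hQ _).2 rfl), factoredWeight_of_mem h]
    obtain ⟨e⟩ := (hQ _).2 rfl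
    rw [Nat.card_congr (surCongrLeft e H), ← Nat.card_congr e.toEquiv]
    rfl
  · rw [factoredWeight_of_notMem h, mul_zero, ENNReal.tsum_eq_zero]
    refine fun b => if_neg ?_
    rintro ⟨e⟩
    apply h
    have := b.out.natCard_mem_factoredNumbers
    rwa [← Nat.card_congr e.toEquiv] at this

/-! ### Cohen–Lenstra moments -/

section Moments

variable {P : Finset ℕ}

lemma natCard_aut_ne_zero (G : FinAbGroup P) : (Nat.card (G ≃+ G) : ℝ≥0∞) ≠ 0 := by
  have : Nonempty (G ≃+ G) := ⟨AddEquiv.refl _⟩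
  exact_mod_cast Nat.card_pos.ne'

/-- The proportion of homomorphisms `ℤⁿ → G` that are surjective. -/
def surDensity (n : ℕ) (G : Type) [AddCommGroup G] : ℝ≥0∞ :=
  (Nat.card (Sur (Fin n → ℤ) G) : ℝ≥0∞) * ((Nat.card G : ℝ≥0∞) ^ n)⁻¹

lemma tsum_moment_mul_surDensity (H : FinAbGroup P) (n : ℕ) :
    ∑' b : IsoType P, (Nat.card (Sur b.out H) : ℝ≥0∞) / (Nat.card (b.out ≃+ b.out) : ℝ≥0∞) *
        surDensity n b.out =
      surDensity n H * subgroupZeta P (Fin n → ℤ) n := by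
  classical
  have h1 : ∀ b : IsoType P,
      (Nat.card (Sur b.out H) : ℝ≥0∞) / (Nat.card (b.out ≃+ b.out) : ℝ≥0∞) *
        surDensity n b.out =
      ∑' L : AddSubgroup (Fin n → ℤ), (if Nonempty ((Fin n → ℤ) ⧸ L ≃+ b.out) then
        (Nat.card (Sur b.out H) : ℝ≥0∞) * ((Nat.card b.out : ℝ≥0∞) ^ n)⁻¹ else 0) := by
    intro b
    rw [surDensity, natCard_sur_eq_tsum (M := Fin n → ℤ), ← ENNReal.tsum_mul_right,
      ← ENNReal.tsum_mul_left]
    refine tsum_congr fun L => ?_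
    split_ifs
    · rw [mul_left_comm, ENNReal.div_eq_inv_mul, ← mul_assoc, ← mul_assoc,
        ENNReal.mul_inv_cancel (natCard_aut_ne_zero _) (ENNReal.natCast_ne_top _), one_mul]
    · simp
  simp only [h1]
  rw [ENNReal.tsum_comm]
  simp only [tsum_isoType_quotient]
  rw [tsum_natCard_sur_quotient]
  have h2 : ∀ f : Sur (Fin n → ℤ) H, factoredWeight P n f.1.ker.index *
      subgroupZeta P f.1.ker n =
      ((Nat.card H : ℝ≥0∞) ^ n)⁻¹ * subgroupZeta P (Fin n → ℤ) n := by
    intro f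
    have hf : f.1.ker.index = Nat.card H := by
      rw [AddSubgroup.index_ker, AddMonoidHom.range_eq_top.2 f.2, AddSubgroup.card_top]
    rw [subgroupZeta_of_index_ne_zero, hf, factoredWeight_of_mem H.natCard_mem_factoredNumbers]
    rw [hf]
    exact Nat.card_pos.ne'
  simp only [h2]
  rw [ENNReal.tsum_const, ENat.card_eq_coe_natCard, ENat.toENNReal_coe, surDensity, mul_assoc]

lemma natCard_int_pow_hom (n : ℕ) (G : Type) [AddCommGroup G] :
    Nat.card ((Fin n → ℤ) →+ G) = Nat.card G ^ n := by
  rw [Nat.card_congr ((addMonoidHomLequivInt ℤ).toEquiv.trans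
    ((Pi.basisFun ℤ (Fin n)).constr ℤ).symm.toEquiv), Nat.card_fun, Nat.card_fin]

lemma natCard_sur_int_pow_le (n : ℕ) (G : Type) [AddCommGroup G] [Finite G] :
    Nat.card (Sur (Fin n → ℤ) G) ≤ Nat.card G ^ n := by
  rw [← natCard_int_pow_hom]
  exact Nat.card_le_card_of_injective _ Subtype.val_injective

/-- A homomorphism that is not onto factors through its image, a proper subgroup. -/
lemma natCard_pow_le_natCard_sur_add (n : ℕ) (G : Type) [AddCommGroup G] [Finite G] :
    Nat.card G ^ n ≤ Nat.card (Sur (Fin n → ℤ) G) +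
      ∑ᶠ K : {K : AddSubgroup G // K ≠ ⊤}, Nat.card K.1 ^ n := by
  classical
  have := Fintype.ofFinite {K : AddSubgroup G // K ≠ ⊤}
  let F : ((Fin n → ℤ) →+ G) →
      Sur (Fin n → ℤ) G ⊕ (Σ K : {K : AddSubgroup G // K ≠ ⊤}, ((Fin n → ℤ) →+ K.1)) := fun f =>
    if h : Function.Surjective f then Sum.inl ⟨f, h⟩
    else Sum.inr ⟨⟨f.range, fun h' => h (AddMonoidHom.range_eq_top.1 h')⟩, f.rangeRestrict⟩
  let F' : (Sur (Fin n → ℤ) G ⊕ (Σ K : {K : AddSubgroup G // K ≠ ⊤}, ((Fin n → ℤ) →+ K.1))) →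
      ((Fin n → ℤ) →+ G) := Sum.elim Subtype.val fun z => z.1.1.subtype.comp z.2
  have hF : Function.LeftInverse F' F := by
    intro f
    by_cases h : Function.Surjective f
    · simp only [F, F', dif_pos h]
      rfl
    · simp only [F, F', dif_neg h]
      rfl
  have := Nat.card_le_card_of_injective F hF.injective
  rw [natCard_int_pow_hom, Nat.card_sum, Nat.card_sigma] at this
  rw [finsum_eq_sum_of_fintype]
  simpa only [natCard_int_pow_hom] using this

lemma surDensity_le_one (n : ℕ) (G : Type) [AddCommGroup G] [Finite G] : surDensity n G ≤ 1 := by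
  rw [surDensity, ← div_eq_mul_inv]
  refine ENNReal.div_le_of_le_mul ?_
  rw [one_mul, ← Nat.cast_pow]
  exact Nat.cast_le.2 (natCard_sur_int_pow_le n G)

lemma tendsto_surDensity (G : Type) [AddCommGroup G] [Finite G] :
    Tendsto (fun n => surDensity n G) atTop (𝓝 1) := by
  have hG : (0 : ℝ) < Nat.card G := by exact_mod_cast Nat.card_pos
  have := Fintype.ofFinite {K : AddSubgroup G // K ≠ ⊤}
  have key : Tendsto (fun n => (Nat.card (Sur (Fin n → ℤ) G) : ℝ) / (Nat.card G : ℝ) ^ n)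
      atTop (𝓝 1) := by
    have h0 : Tendsto (fun n : ℕ => 1 - ∑ K : {K : AddSubgroup G // K ≠ ⊤},
        ((Nat.card K.1 : ℝ) / Nat.card G) ^ n) atTop (𝓝 1) := by
      have : Tendsto (fun n : ℕ => ∑ K : {K : AddSubgroup G // K ≠ ⊤},
          ((Nat.card K.1 : ℝ) / Nat.card G) ^ n) atTop (𝓝 0) := by
        rw [← Finset.sum_const_zero (s := (Finset.univ : Finset {K : AddSubgroup G // K ≠ ⊤}))]
        refine tendsto_finsetSum _ fun K _ => tendsto_pow_atTop_nhds_zero_of_lt_one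
          (by positivity) ?_
        rw [div_lt_one hG]
        have h1 : Nat.card K.1 ≠ Nat.card G := fun h => K.2 (AddSubgroup.eq_top_of_card_eq _ h)
        exact_mod_cast lt_of_le_of_ne (AddSubgroup.card_le_card_addGroup K.1) h1
      simpa using this.const_sub 1
    refine tendsto_of_tendsto_of_tendsto_of_le_of_le h0 tendsto_const_nhds (fun n => ?_)
      fun n => ?_
    · have := natCard_pow_le_natCard_sur_add n G
      rw [finsum_eq_sum_of_fintype] at this
      have h2 : (Nat.card G : ℝ) ^ n ≤ Nat.card (Sur (Fin n → ℤ) G) +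
        ∑ K : {K : AddSubgroup G // K ≠ ⊤}, (Nat.card K.1 : ℝ) ^ n := by exact_mod_cast this
      simp only [div_pow, ← Finset.sum_div]
      rw [sub_le_iff_le_add, ← add_div, one_le_div (by positivity)]
      exact h2
    · rw [div_le_one (by positivity), ← Nat.cast_pow]
      exact Nat.cast_le.2 (natCard_sur_int_pow_le n G)
  have := ENNReal.tendsto_ofReal key
  rw [ENNReal.ofReal_one] at this
  refine this.congr fun n => ?_
  rw [ENNReal.ofReal_div_of_pos (by positivity), ENNReal.ofReal_natCast, ENNReal.ofReal_pow hG.le,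
    ENNReal.ofReal_natCast, surDensity, div_eq_mul_inv]

/-- Fatou for counting measure bounds the sum by c, and s ≤ 1 gives the reverse; summability of a
need not be known beforehand. -/
lemma tsum_eq_of_tendsto_tsum_mul {ι : Type*} (a : ι → ℝ≥0∞) (s : ℕ → ι → ℝ≥0∞) {c : ℝ≥0∞}
    (hs : ∀ n i, s n i ≤ 1) (hs' : ∀ i, Tendsto (fun n => s n i) atTop (𝓝 1))
    (hc : Tendsto (fun n => ∑' i, a i * s n i) atTop (𝓝 c)) : ∑' i, a i = c := by
  apply le_antisymm
  · let _ : MeasurableSpace ι := ⊤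
    have h := MeasureTheory.lintegral_liminf_le (μ := MeasureTheory.Measure.count) (u := atTop)
      (f := fun (n : ℕ) i => a i * s n i) fun n => measurable_from_top
    simp only [MeasureTheory.lintegral_count] at h
    rw [hc.liminf_eq] at h
    refine le_of_eq_of_le (tsum_congr fun i => ?_) h
    have : Tendsto (fun n => a i * s n i) atTop (𝓝 (a i * 1)) :=
      ENNReal.Tendsto.const_mul (hs' i) (Or.inl one_ne_zero)
    rw [this.liminf_eq, mul_one]
  · exact le_of_tendsto' hc fun n => ENNReal.tsum_le_tsum fun i =>
      mul_le_of_le_one_right' (hs n i)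

/-- The surjection moments of the Cohen–Lenstra measure. -/
lemma tsum_natCard_sur_div_natCard_aut (hP : ∀ p ∈ P, p.Prime) (H : FinAbGroup P) :
    ∑' b : IsoType P, (Nat.card (Sur b.out H) : ℝ≥0∞) / (Nat.card (b.out ≃+ b.out) : ℝ≥0∞) =
      ENNReal.ofReal (normConst P 1)⁻¹ := by
  have h := ENNReal.Tendsto.mul (tendsto_surDensity H) (Or.inl one_ne_zero)
    (tendsto_subgroupZeta_int_pow hP) (Or.inr ENNReal.one_ne_top)
  rw [one_mul] at h
  exact tsum_eq_of_tendsto_tsum_mul _ (fun n (b : IsoType P) => surDensity n b.out)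
    (fun n b => surDensity_le_one n _) (fun b => tendsto_surDensity _)
    (h.congr fun n => (tsum_moment_mul_surDensity H n).symm)

end Moments

/-! ### Summing over chains of isomorphism types -/

lemma surCount_castSucc {P : Finset ℕ} {k : ℕ} (B : Fin (k + 1) → FinAbGroup P) (i : Fin k) :
    surCount B i.castSucc = surCount (fun j => B j.castSucc) i := by
  rcases i with ⟨_ | i, h⟩ <;> rfl

/-- The trivial group. -/
def FinAbGroup.trivial (P : Finset ℕ) : FinAbGroup P where
  carrier := PUnit
  prime_mem p hp h := by
    rw [Nat.card_unique, Nat.dvd_one] at h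
    exact absurd h hp.ne_one

/-- The group `G_k`, or the trivial group if `k = 0`. -/
def lastGroup {P : Finset ℕ} : ∀ {k : ℕ}, (Fin k → FinAbGroup P) → FinAbGroup P
  | 0, _ => FinAbGroup.trivial P
  | k + 1, B => B (Fin.last k)

lemma surCount_last {P : Finset ℕ} {k : ℕ} (B : Fin (k + 1) → FinAbGroup P) :
    surCount B (Fin.last k) =
      Nat.card (Sur (B (Fin.last k)) (lastGroup fun j : Fin k => B j.castSucc)) := by
  cases k <;> rfl

/-- Summing out the top group contributes the same constant for every choice of the group below it;
the trivial group plays that role at the bottom. -/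
lemma tsum_prod_surCount_div {P : Finset ℕ} (hP : ∀ p ∈ P, p.Prime) (k : ℕ) :
    ∑' b : Fin k → IsoType P, ∏ i, (surCount (fun j => (b j).out) i : ℝ≥0∞) /
        (Nat.card ((b i).out ≃+ (b i).out) : ℝ≥0∞) =
      ENNReal.ofReal (normConst P 1)⁻¹ ^ k := by
  induction k with
  | zero => simp
  | succ k ih =>
    have key : ∀ (b : Fin k → IsoType P) (a : IsoType P) (c : Fin (k + 1) → IsoType P),
        (∀ j, c j.castSucc = b j) → c (Fin.last k) = a →
        ∏ i, (surCount (fun j => (c j).out) i : ℝ≥0∞) /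
            (Nat.card ((c i).out ≃+ (c i).out) : ℝ≥0∞) =
          (∏ i, (surCount (fun j => (b j).out) i : ℝ≥0∞) /
            (Nat.card ((b i).out ≃+ (b i).out) : ℝ≥0∞)) *
          ((Nat.card (Sur a.out (lastGroup fun j => (b j).out)) : ℝ≥0∞) /
            (Nat.card (a.out ≃+ a.out) : ℝ≥0∞)) := by
      rintro b a c hc rfl
      obtain rfl : (fun j => c j.castSucc) = b := funext hc
      rw [Fin.prod_univ_castSucc, surCount_last]
      simp only [surCount_castSucc]
    rw [← (Fin.snocEquiv fun _ => IsoType P).tsum_eq, ENNReal.tsum_prod', ENNReal.tsum_comm,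
      pow_succ, ← ih, ← ENNReal.tsum_mul_right]
    refine tsum_congr fun b => ?_
    rw [← tsum_natCard_sur_div_natCard_aut hP (lastGroup fun j => (b j).out),
      ← ENNReal.tsum_mul_left]
    exact tsum_congr fun a => key b a _ (fun j => by simp [Fin.snocEquiv])
      (by simp [Fin.snocEquiv])

/-! ### Orbit counting for k-sequences -/

namespace KSequence

variable {P : Finset ℕ} {k : ℕ}

/-- A family of surjections between given groups. -/
abbrev SurFamily (B : Fin k → FinAbGroup P) : Type :=
  ∀ (i : ℕ) (h : i + 1 < k), Sur (B ⟨i + 1, h⟩) (B ⟨i, Nat.lt_of_succ_lt h⟩)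

instance finite_surFamily (B : Fin k → FinAbGroup P) : Finite (SurFamily B) :=
  Finite.of_injective (fun φ (i : Fin k) (h : i.1 + 1 < k) => φ i.1 h) fun _ _ h =>
    funext fun i => funext fun hi =>
      congrFun (congrFun h ⟨i, Nat.lt_of_succ_lt hi⟩) hi

/-- The `k`-sequence given by a family of surjections. -/
def ofFamily (B : Fin k → FinAbGroup P) (φ : SurFamily B) : KSequence P k where
  G := B
  φ i h := (φ i h).1
  surjective i h := (φ i h).2

/-- Transport of structure: any family of group isomorphisms from the groups of a `k`-sequence is
an isomorphism onto a unique `k`-sequence on the target groups. -/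
def sigmaIsoEquiv (S : KSequence P k) (B : Fin k → FinAbGroup P) :
    (Σ φ : SurFamily B, Iso S (ofFamily B φ)) ≃ ∀ i, S.G i ≃+ B i :=
  Equiv.ofBijective (fun z => z.2.equiv) <| by
    constructor
    · rintro ⟨φ, e⟩ ⟨φ', e'⟩ h
      have h : e.equiv = e'.equiv := h
      obtain rfl : φ = φ' := by
        funext i hi
        refine Subtype.ext (AddMonoidHom.ext fun y => ?_)
        obtain ⟨x, rfl⟩ := (e.equiv ⟨i + 1, hi⟩).surjective y
        have h1 := e.comm i hi x
        have h2 := e'.comm i hi x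
        rw [← h] at h2
        exact h1.symm.trans h2
      congr 1
      exact Iso.ext h
    · intro e
      refine ⟨⟨fun i h => ⟨((e _).toAddMonoidHom.comp (S.φ i h)).comp (e _).symm.toAddMonoidHom,
        ((e _).surjective.comp (S.surjective i h)).comp (e _).symm.surjective⟩,
        ⟨e, fun i h x => ?_⟩⟩, rfl⟩
      change _ = e _ (S.φ i h ((e _).symm (e _ x)))
      rw [AddEquiv.symm_apply_apply]
      rfl

instance finite_iso (S T : KSequence P k) : Finite (Iso S T) :=
  Finite.of_injective (fun e => e.equiv) fun _ _ h => Iso.ext h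

lemma natCard_iso {S T : KSequence P k} (e : Iso S T) : Nat.card (Iso S T) = Nat.card S.Aut := by
  refine Nat.card_congr
    { toFun := fun f => f.trans e.symm
      invFun := fun f => f.trans e
      left_inv := fun f => ?_
      right_inv := fun f => ?_ }
  · ext i x; exact (e.equiv i).apply_symm_apply _
  · ext i x; exact (e.equiv i).symm_apply_apply _

lemma toClass_eq_iff {S T : KSequence P k} : S.toClass = T.toClass ↔ Nonempty (Iso S T) :=
  Quotient.eq

lemma natCard_aut_ne_zero (S : KSequence P k) : Nat.card S.Aut ≠ 0 := by
  have : Nonempty S.Aut := ⟨Iso.refl S⟩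
  exact Nat.card_pos.ne'

end KSequence

namespace KSequenceClass

variable {P : Finset ℕ} {k : ℕ}

/-- The number of automorphisms of a class of `k`-sequences. -/
def autCard : KSequenceClass P k → ℕ :=
  Quotient.lift (fun S : KSequence P k => Nat.card S.Aut) fun S T ⟨e⟩ => by
    rw [← KSequence.natCard_iso e, ← KSequence.natCard_iso e.symm]
    exact Nat.card_congr ⟨fun f => f.symm, fun f => f.symm, fun _ => rfl, fun _ => rfl⟩

lemma autCard_toClass (S : KSequence P k) : autCard S.toClass = Nat.card S.Aut := rfl

open Classical in
-- Orbit–stabilizer in disguise: count tuples of isomorphisms S.G i ≃ B i. Each transports S to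
-- exactly one family, and a family in the class of S is hit #Aut(S) times.
lemma tsum_family_toClass_eq (B : Fin k → FinAbGroup P) (S : KSequence P k)
    (hS : S.toClass.isoTypes = fun i => (B i).isoType) :
    (∑' φ : KSequence.SurFamily B,
        if (KSequence.ofFamily B φ).toClass = S.toClass then (1 : ℝ≥0∞) else 0) *
        (Nat.card S.Aut : ℝ≥0∞) =
      ∏ i, (Nat.card (B i ≃+ B i) : ℝ≥0∞) := by
  have e : ∀ i, S.G i ≃+ B i := fun i =>
    (FinAbGroup.isoType_eq_iff.1 (congrFun hS i)).some
  have h1 : Nat.card (∀ i, S.G i ≃+ B i) = ∏ i, Nat.card (B i ≃+ B i) := by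
    rw [Nat.card_pi]
    refine Finset.prod_congr rfl fun i _ => Nat.card_congr
      { toFun := fun f => (e i).symm.trans f
        invFun := fun f => (e i).trans f
        left_inv := fun f => by ext; simp
        right_inv := fun f => by ext; simp }
  rw [← Nat.cast_prod, ← h1, ← tsum_one_eq_natCard (∀ i, S.G i ≃+ B i),
    ← (S.sigmaIsoEquiv B).tsum_eq, ENNReal.tsum_sigma', ← ENNReal.tsum_mul_right]
  refine tsum_congr fun φ => ?_
  rw [tsum_one_eq_natCard]
  split_ifs with h
  · rw [KSequence.natCard_iso (KSequence.toClass_eq_iff.1 h.symm).some, one_mul]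
  · have : IsEmpty (KSequence.Iso S (KSequence.ofFamily B φ)) :=
      not_nonempty_iff.1 fun h' => h (KSequence.toClass_eq_iff.2 h').symm
    simp

lemma natCard_surFamily (B : Fin k → FinAbGroup P) :
    Nat.card (KSequence.SurFamily B) = ∏ i, surCount B i := by
  cases k with
  | zero =>
    have : Unique (KSequence.SurFamily B) := ⟨⟨fun i h => by omega⟩, fun φ => by
      funext i h; omega⟩
    simp
  | succ k =>
    -- The convention B_0 = 0 supplies a factor 1, reconciling k factors with k - 1 maps.
    have h0 : surCount B 0 = 1 := by
      change Nat.card (Sur (B 0) PUnit) = 1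
      rw [Nat.card_eq_one_iff_unique]
      exact ⟨⟨fun f g => Subtype.ext (by ext)⟩, ⟨⟨0, fun y => ⟨0, rfl⟩⟩⟩⟩
    rw [Fin.prod_univ_succ, h0, one_mul]
    have h1 : ∀ i : Fin k, surCount B i.succ = Nat.card (Sur (B i.succ) (B i.castSucc)) :=
      fun i => rfl
    simp only [h1]
    rw [← Nat.card_pi]
    exact Nat.card_congr
      { toFun := fun φ i => φ i.1 (Nat.succ_lt_succ i.2)
        invFun := fun φ i h => φ ⟨i, Nat.lt_of_succ_lt_succ h⟩
        left_inv := fun _ => rfl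
        right_inv := fun _ => rfl }

open Classical in
/-- The total mass of the classes of `k`-sequences on given groups. -/
lemma tsum_isoTypes_eq (B : Fin k → FinAbGroup P) :
    ∑' c : KSequenceClass P k,
        (if (fun i => (B i).isoType) = c.isoTypes then (c.autCard : ℝ≥0∞)⁻¹ else 0) =
      ∏ i, (surCount B i : ℝ≥0∞) / (Nat.card (B i ≃+ B i) : ℝ≥0∞) := by
  have hA : ∏ i, (Nat.card (B i ≃+ B i) : ℝ≥0∞) ≠ 0 :=
    Finset.prod_ne_zero_iff.2 fun i _ => _root_.natCard_aut_ne_zero (B i)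
  have hA' : ∏ i, (Nat.card (B i ≃+ B i) : ℝ≥0∞) ≠ ∞ :=
    ENNReal.prod_ne_top fun i _ => ENNReal.natCast_ne_top _
  -- Each class weighs the number of families representing it over ∏ #Aut(B_i); every family then
  -- counts once.
  have h1 : ∀ c : KSequenceClass P k,
      (if (fun i => (B i).isoType) = c.isoTypes then (c.autCard : ℝ≥0∞)⁻¹ else 0) =
        (∑' φ : KSequence.SurFamily B,
          if (KSequence.ofFamily B φ).toClass = c then (1 : ℝ≥0∞) else 0) *
          (∏ i, (Nat.card (B i ≃+ B i) : ℝ≥0∞))⁻¹ := by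
    intro c
    obtain ⟨S, rfl⟩ : ∃ S : KSequence P k, S.toClass = c := Quotient.exists_rep c
    split_ifs with h
    · rw [autCard_toClass]
      have ha : (Nat.card S.Aut : ℝ≥0∞) ≠ 0 := by exact_mod_cast S.natCard_aut_ne_zero
      have ha' : (Nat.card S.Aut : ℝ≥0∞) ≠ ∞ := ENNReal.natCast_ne_top _
      rw [← div_eq_mul_inv, ENNReal.eq_div_iff hA hA',
        ← tsum_family_toClass_eq B S h.symm, mul_assoc, ENNReal.mul_inv_cancel ha ha', mul_one]
    · rw [ENNReal.tsum_eq_zero.2, zero_mul]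
      refine fun φ => if_neg fun h' => h ?_
      rw [← h']
      rfl
  simp only [h1]
  have h2 : ∀ φ : KSequence.SurFamily B, ∑' c : KSequenceClass P k,
      (if (KSequence.ofFamily B φ).toClass = c then (1 : ℝ≥0∞) else 0) = 1 := fun φ => by
    rw [tsum_eq_single (KSequence.ofFamily B φ).toClass fun c hc => if_neg hc.symm, if_pos rfl]
  rw [ENNReal.tsum_mul_right, ENNReal.tsum_comm]
  simp only [h2]
  rw [tsum_one_eq_natCard, natCard_surFamily, Nat.cast_prod]
  simp only [div_eq_mul_inv]
  rw [Finset.prod_mul_distrib, ENNReal.prod_inv_distrib]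
  exact fun i _ j _ _ => Or.inr (ENNReal.natCast_ne_top _)

lemma tsum_inv_autCard (hP : ∀ p ∈ P, p.Prime) :
    ∑' c : KSequenceClass P k, (c.autCard : ℝ≥0∞)⁻¹ =
      ENNReal.ofReal (normConst P 1)⁻¹ ^ k := by
  classical
  rw [← tsum_prod_surCount_div hP k]
  simp only [← tsum_isoTypes_eq, IsoType.isoType_out]
  -- Each class has exactly one tuple of isomorphism types.
  rw [ENNReal.tsum_comm]
  exact tsum_congr fun c => (tsum_ite_eq c.isoTypes fun _ => _).symm

/-- The measure on classes of `k`-sequences inversely proportional to the number of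
automorphisms. -/
def autMeasure (hP : ∀ p ∈ P, p.Prime) (k : ℕ) : PMF (KSequenceClass P k) :=
  ⟨fun c => ENNReal.ofReal (normConst P k) * (c.autCard : ℝ≥0∞)⁻¹, by
    have h : ∑' c : KSequenceClass P k,
        ENNReal.ofReal (normConst P k) * (c.autCard : ℝ≥0∞)⁻¹ = 1 := by
      have h1 := normConst_pos hP 1
      rw [ENNReal.tsum_mul_left, tsum_inv_autCard hP, normConst_eq_pow,
        ENNReal.ofReal_pow h1.le, ← mul_pow, ← ENNReal.ofReal_mul h1.le,
        mul_inv_cancel₀ h1.ne', ENNReal.ofReal_one, one_pow]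
    exact h ▸ ENNReal.summable.hasSum⟩

lemma autMeasure_apply (hP : ∀ p ∈ P, p.Prime) (c : KSequenceClass P k) :
    autMeasure hP k c = ENNReal.ofReal (normConst P k) * (c.autCard : ℝ≥0∞)⁻¹ := rfl

end KSequenceClass

end

theorem theorem1p4 (k : ℕ) (hk : 1 ≤ k) (P : Finset ℕ) (hP : ∀ p ∈ P, p.Prime) :
    ∃ μ : PMF (KSequenceClass P k),
      (∀ S : KSequence P k,
        (μ S.toClass).toReal = normConst P k / (Nat.card S.Aut : ℝ)) ∧
      ∀ B : Fin k → FinAbGroup P,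
        (μ.map KSequenceClass.isoTypes (fun i => (B i).isoType)).toReal = limitLaw P k B := by
  classical
  refine ⟨KSequenceClass.autMeasure hP k, fun S => ?_, fun B => ?_⟩
  · rw [KSequenceClass.autMeasure_apply, KSequenceClass.autCard_toClass, ENNReal.toReal_mul,
      ENNReal.toReal_ofReal (normConst_pos hP k).le, ENNReal.toReal_inv, ENNReal.toReal_natCast,
      div_eq_mul_inv]
  · rw [PMF.map_apply]
    simp only [KSequenceClass.autMeasure_apply, ← mul_ite_zero]
    have h := KSequenceClass.tsum_isoTypes_eq B
    rw [ENNReal.tsum_mul_left, Eq.trans (tsum_congr fun c => by congr) h, ENNReal.toReal_mul,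
      ENNReal.toReal_ofReal (normConst_pos hP k).le, ENNReal.toReal_prod, limitLaw]
    simp only [ENNReal.toReal_div, ENNReal.toReal_natCast]
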